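/- **Model.** The typical base station (BS) is at the origin of the plane; the other BSs and the eavesdroppers form independent homogeneous Poisson point processes with densities $\lambda_b\ge 0$ and $\lambda_e>0$. A receiver receives a BS only within distance $r>0$. The path loss over distance $x$ is $b\max(d_0,x)^{-\alpha}$, $b>0$, $d_0\ge 0$, with $\alpha=\alpha_L>0$ on line-of-sight (LOS) links and $\alpha=\alpha_N>0$ on reflected links; reflected signals are also multiplied by the reflection coefficient $\rho\in[0,1]$. Each BS transmits with power $P_t>0$; $\mathbb E[G_e]>0$ is the mean gain, at an eavesdropper, of the ideal sector antenna (gain $G_m$ in the main lobe of beamwidth $\vartheta$, $G_s$ outside) whose misalignment is a centred normal law truncated to $[0,\vartheta/2]$. The obstacles have density $\lambda_0$, mean length $\mathbb E[l]$, mean width $\mathbb E[w]$ and height distribution function $F_H$. The geometry $g=(d,D,\tau,\theta)$ of the typical BS–eavesdropper link (distances $d>0$ and $D>0$, propagation delay $\tau$ with $c\tau\ge D$, angle $\theta$) may be random. Put $$P_{Los}=e^{-k(\beta_0 d+p)},\quad \beta_0=\tfrac{2\lambda_0(\mathbb E[l]+\mathbb E[w])}{\pi},\quad p=\lambda_0\mathbb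 E[l]\mathbb E[w],\quad k=1-\int_0^1F_H(sH_u+(1-s)H_b)\,ds,$$ $$P_{Ref}=\exp\Bigl(-\lambda_0\bigl(\mathbb E[l]\sqrt{c^2\tau^2-D^2\cos^2\theta}+\mathbb E[w]D|\cos\theta|+\mathbb E[l]\mathbb E[w]-\tfrac{\mathbb E[l](c\tau-D)}4-\tfrac{\mathbb E[l]^2\sqrt{c^2\tau^2-D^2}}{8D}\bigr)\Bigr),$$ where $H_b,H_u$ are the heights of BS and user. Given $g$, every BS–eavesdropper pair has an unblocked LOS path with probability $P_{Los}$ and, independently of that, an unblocked reflection path with probability $P_{Ref}$. A link is LOS if it has only the first, reflected if it has only the second, and otherwise contributes nothing. The paths and $g$ are independent of the two point processes. With time switching ratio $\eta\in(0,1)$, the eavesdroppers within distance $r$ of the typical BS collude by maximal-ratio combining, so that $$\mathrm{SINR}=\frac{S_{Los}+S_{Ref}}{I_{Los}+I_{Ref}+I_{x,e}+\sigma_e^2}.$$ Here $S_{Los},S_{Ref}$ are the sums over these eavesdroppers of $(1-\eta)$ times the power received from the typical BS over LOS and over reflected links, $I_{Los},I_{Ref}$ are the same sums with $\eta$ in place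 of $1-\eta$, and $I_{x,e}$ is the sum over these eavesdroppers and all other BSs within distance $r$ of them of the power received over LOS and reflected links. The eavesdropping success probability (ESP) is $P(\mathrm{SINR}>\beta)$. The approximate ESP is the same probability with the noise $\sigma_e^2$ neglected and each of the five sums replaced by its mean over the point processes and the links, given $g$. **Theorem.** Let $$B=P_{Los}(1-P_{Ref})\frac{2}{r^{\alpha_L}(2-\alpha_L)}+\rho(1-P_{Los})P_{Ref}\frac{2}{r^{\alpha_N}(2-\alpha_N)} .$$ Assume $\alpha_L,\alpha_N\ne2$, $B\neq0$ almost surely, and $d_0>0$ or $\alpha_L,\alpha_N<2$. Then the five sums have finite means, the mean total interference given $g$ is almost surely positive, and for every threshold $\beta$ the approximate ESP of the colluding eavesdroppers equals $$P\left(\frac{(1-\eta)\,B}{(\pi r^2\lambda_b+\eta)\,B}>\beta\right).$$ If $d_0=0$ (path loss $b\,x^{-\alpha}$), then moreover, almost surely, the mean total signal power and the mean total interference power given $g$ are $\pi r^2\lambda_eP_t\mathbb E[G_e]\,b\,(1-\eta)B$ and $\pi r^2\lambda_eP_t\mathbb E[G_e]\,b\,(\pi r^2\lambda_b+\eta)B$.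 -/

import Mathlib

open MeasureTheory ProbabilityTheory Set
open scoped NNReal ENNReal

noncomputable section

namespace MmWave

/-- The plane in which base stations and eavesdroppers are located. -/
abbrev Plane : Type := EuclideanSpace ℝ (Fin 2)

/-- The counting measure of a set of points of the plane. -/
def pointMeasure (S : Set Plane) : Measure Plane := Measure.count.restrict S

/-- `Φ` is a homogeneous Poisson point process in the plane with density `lam`: a random locally
finite set whose numbers of points in bounded Borel sets are Poisson with mean `lam * area`, and
independent for disjoint sets. -/
structure IsHPPP {Ω : Type*} [MeasurableSpace Ω] (μ : Measure Ω) (Φ : Ω → Set Plane)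
    (lam : ℝ≥0) : Prop where
  locallyFinite : ∀ ω, ∀ R : ℝ, (Φ ω ∩ Metric.closedBall 0 R).Finite
  measurable : Measurable fun ω => pointMeasure (Φ ω)
  law : ∀ A : Set Plane, MeasurableSet A → Bornology.IsBounded A →
    μ.map (fun ω => (Φ ω ∩ A).ncard) = poissonMeasure (lam * (volume A).toNNReal)
  indep : ∀ (n : ℕ) (A : Fin n → Set Plane), (∀ i, MeasurableSet (A i)) →
    (∀ i, Bornology.IsBounded (A i)) → Pairwise (fun i j => Disjoint (A i) (A j)) →
    iIndepFun (fun i ω => (Φ ω ∩ A i).ncard) μ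

/-- The deterministic parameters of the network. -/
structure Params where
  /-- time switching ratio -/
  η : ℝ
  η_pos : 0 < η
  η_lt_one : η < 1
  /-- transmission power of a base station -/
  Pt : ℝ
  Pt_pos : 0 < Pt
  /-- main lobe gain -/
  Gm : ℝ
  Gm_pos : 0 < Gm
  /-- side lobe gain -/
  Gs : ℝ
  Gs_nonneg : 0 ≤ Gs
  /-- beamwidth of the main lobe -/
  beamwidth : ℝ
  beamwidth_pos : 0 < beamwidth
  /-- variance parameter of the beam misalignment -/
  misVar : ℝ≥0
  misVar_pos : 0 < misVar
  /-- constant factor of the path loss, usually `(c / (4 π f_c)) ^ 2` -/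
  b : ℝ
  b_pos : 0 < b
  /-- reference distance of the path loss; `0` stands for the pure power law -/
  dref : ℝ
  dref_nonneg : 0 ≤ dref
  /-- path loss exponent of line-of-sight links -/
  αL : ℝ
  αL_pos : 0 < αL
  /-- path loss exponent of reflected links -/
  αN : ℝ
  αN_pos : 0 < αN
  /-- reflection coefficient -/
  ρ : ℝ
  ρ_nonneg : 0 ≤ ρ
  ρ_le_one : ρ ≤ 1
  /-- density of the base stations -/
  lamB : ℝ≥0
  /-- density of the eavesdroppers -/
  lamE : ℝ≥0
  lamE_pos : 0 < lamE
  /-- largest distance from which signals are received -/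
  r : ℝ
  r_pos : 0 < r
  /-- noise power -/
  noise : ℝ
  noise_nonneg : 0 ≤ noise
  /-- speed of propagation -/
  c : ℝ
  c_pos : 0 < c
  /-- density of the obstacles and reflectors -/
  lam0 : ℝ≥0
  /-- law of the length of an object -/
  lenLaw : Measure ℝ
  lenLaw_prob : IsProbabilityMeasure lenLaw
  lenLaw_nonneg : ∀ᵐ l ∂lenLaw, 0 ≤ l
  lenLaw_integrable : Integrable (fun l : ℝ => l) lenLaw
  /-- law of the width of an object -/
  widLaw : Measure ℝ
  widLaw_prob : IsProbabilityMeasure widLaw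
  widLaw_nonneg : ∀ᵐ w ∂widLaw, 0 ≤ w
  widLaw_integrable : Integrable (fun w : ℝ => w) widLaw
  /-- law of the height of an object -/
  heightLaw : Measure ℝ
  heightLaw_prob : IsProbabilityMeasure heightLaw
  /-- height of a base station -/
  Hb : ℝ
  /-- height of a user -/
  Hu : ℝ

namespace Params

variable (p : Params)

/-- mean length of an object -/
def meanLen : ℝ := ∫ l, l ∂p.lenLaw

/-- mean width of an object -/
def meanWid : ℝ := ∫ w, w ∂p.widLaw

/-- `β₀`, the mean number of objects met per unit of distance -/
def β₀ : ℝ := 2 * p.lam0 * (p.meanLen + p.meanWid) / Real.pi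

/-- the constant `p` in the mean number `β₀ d + p` of objects met by a link of length `d` -/
def objConst : ℝ := p.lam0 * p.meanLen * p.meanWid

/-- the height scaling factor `k = 1 - ∫₀¹ F_H (s H_u + (1 - s) H_b) ds`, with `F_H` the
distribution function of the height of an object -/
def heightFactor : ℝ := 1 - ∫ s in (0 : ℝ)..1, cdf p.heightLaw (s * p.Hu + (1 - s) * p.Hb)

/-- `P_Los`: the probability that a line-of-sight path of length `d` is not blocked -/
def pLos (d : ℝ) : ℝ := Real.exp (-(p.heightFactor * (p.β₀ * d + p.objConst)))

/-- `P_Ref`: the probability that there is an unblocked first-order reflection path with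
propagation delay `τ`, for a link of length `D` and angle `θ` -/
def pRef (D τ θ : ℝ) : ℝ :=
  Real.exp (-(p.lam0 * (p.meanLen * √(p.c ^ 2 * τ ^ 2 - D ^ 2 * Real.cos θ ^ 2)
    + p.meanWid * D * |Real.cos θ| + p.meanLen * p.meanWid
    - p.meanLen * (p.c * τ - D) / 4
    - p.meanLen ^ 2 * √(p.c ^ 2 * τ ^ 2 - D ^ 2) / (8 * D))))

/-- The ideal sector antenna. -/
def sectorGain (ω : ℝ) : ℝ := if ω ≤ p.beamwidth / 2 then p.Gm else p.Gs

/-- The law of the beam misalignment: a centred normal law truncated to `[0, beamwidth / 2]`. -/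
def misalignmentLaw : Measure ℝ := (gaussianReal 0 p.misVar)[|Icc 0 (p.beamwidth / 2)]

/-- `E[G_e]`: the mean antenna gain obtained by an eavesdropper -/
def meanGain : ℝ := ∫ ω, p.sectorGain ω ∂p.misalignmentLaw

/-- path loss over distance `x` of a link with path loss exponent `α` -/
def pathLoss (α x : ℝ) : ℝ := p.b * (max p.dref x) ^ (-α)

/-- The common bracket of the numerator and the denominator of the approximate SINR, for link
probabilities `PL` and `PR`. -/
def bracket (PL PR : ℝ) : ℝ :=
  PL * (1 - PR) * (2 / (p.r ^ p.αL * (2 - p.αL)))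
    + p.ρ * (1 - PL) * PR * (2 / (p.r ^ p.αN * (2 - p.αN)))

/-- the numerator of the approximate SINR -/
def numer (PL PR : ℝ) : ℝ := (1 - p.η) * p.bracket PL PR

/-- the denominator of the approximate SINR -/
def denom (PL PR : ℝ) : ℝ := (Real.pi * p.r ^ 2 * p.lamB + p.η) * p.bracket PL PR

end Params

/-- The random network. The typical base station is at the origin; `bs` is the set of the other
base stations, `eve` the set of the eavesdroppers. All remaining randomness (the obstacles, hence
the links, and the geometry of the typical link) is in the random element `env`. The link
probabilities are those of the typical link, the same for all links. -/
structure Network (p : Params) {Ω : Type*} (E : Type*) [MeasurableSpace Ω] [MeasurableSpace E]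
    (μ : Measure Ω) where
  bs : Ω → Set Plane
  eve : Ω → Set Plane
  env : Ω → E
  bs_hppp : IsHPPP μ bs p.lamB
  eve_hppp : IsHPPP μ eve p.lamE
  env_measurable : Measurable env
  indep_bs_eve : IndepFun (fun ω => pointMeasure (bs ω)) (fun ω => pointMeasure (eve ω)) μ
  indep_env : IndepFun env (fun ω => (pointMeasure (bs ω), pointMeasure (eve ω))) μ
  /-- distance between the typical base station and an eavesdropper, in `P_Los` -/
  d : E → ℝ
  /-- distance between base station and eavesdropper, in `P_Ref` -/
  D : E → ℝ
  /-- propagation delay of the reflection path -/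
  τ : E → ℝ
  /-- angle of the link, in `P_Ref` -/
  θ : E → ℝ
  d_measurable : Measurable d
  D_measurable : Measurable D
  τ_measurable : Measurable τ
  θ_measurable : Measurable θ
  d_pos : ∀ᵐ ω ∂μ, 0 < d (env ω)
  D_pos : ∀ᵐ ω ∂μ, 0 < D (env ω)
  D_le : ∀ᵐ ω ∂μ, D (env ω) ≤ p.c * τ (env ω)
  /-- `(e, x, y) ∈ los`: in the environment `e` there is an unblocked line-of-sight path from the
  base station at `x` to the eavesdropper at `y` -/
  los : Set (E × Plane × Plane)
  /-- `(e, x, y) ∈ ref`: in the environment `e` there is an unblocked first-order reflection path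
  from the base station at `x` to the eavesdropper at `y` -/
  ref : Set (E × Plane × Plane)
  los_measurable : MeasurableSet los
  ref_measurable : MeasurableSet ref
  los_prob : ∀ x y : Plane, x ≠ y →
    μ[{ω | (env ω, x, y) ∈ los}.indicator (fun _ => (1 : ℝ)) |
        MeasurableSpace.comap (fun ω => (d (env ω), D (env ω), τ (env ω), θ (env ω))) inferInstance]
      =ᵐ[μ] fun ω => p.pLos (d (env ω))
  ref_prob : ∀ x y : Plane, x ≠ y →
    μ[{ω | (env ω, x, y) ∈ ref}.indicator (fun _ => (1 : ℝ)) |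
        MeasurableSpace.comap (fun ω => (d (env ω), D (env ω), τ (env ω), θ (env ω))) inferInstance]
      =ᵐ[μ] fun ω => p.pRef (D (env ω)) (τ (env ω)) (θ (env ω))
  /-- Given the geometry, the two kinds of paths of a link exist independently. -/
  los_ref_prob : ∀ x y : Plane, x ≠ y →
    μ[{ω | (env ω, x, y) ∈ los ∩ ref}.indicator (fun _ => (1 : ℝ)) |
        MeasurableSpace.comap (fun ω => (d (env ω), D (env ω), τ (env ω), θ (env ω))) inferInstance]
      =ᵐ[μ] fun ω => p.pLos (d (env ω)) * p.pRef (D (env ω)) (τ (env ω)) (θ (env ω))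

/-- The five aggregate powers at the central unit of the colluding eavesdroppers: information
signal of the typical base station over line-of-sight and over reflected links, its
power-transfer signal over both, and the interference of the other base stations. -/
structure Powers where
  sLos : ℝ
  sRef : ℝ
  iLos : ℝ
  iRef : ℝ
  iCross : ℝ

/-- total signal power -/
def Powers.signal (P : Powers) : ℝ := P.sLos + P.sRef

/-- total interference power -/
def Powers.interference (P : Powers) : ℝ := P.iLos + P.iRef + P.iCross

/-- SINR after maximal-ratio combining, for a given noise power -/
def Powers.sinr (P : Powers) (noise : ℝ) : ℝ := P.signal / (P.interference + noise)

namespace Network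

variable {p : Params} {Ω E : Type*} [MeasurableSpace Ω] [MeasurableSpace E] {μ : Measure Ω}
  (N : Network p E μ)

open scoped Classical in
/-- power received at `y` from the base station at `x` over a line-of-sight link (a link with a
line-of-sight path and no reflection path) of length at most `r` -/
def losPower (ω : Ω) (x y : Plane) : ℝ :=
  if dist x y ≤ p.r ∧ (N.env ω, x, y) ∈ N.los \ N.ref then
    p.Pt * p.meanGain * p.pathLoss p.αL (dist x y) else 0

open scoped Classical in
/-- power received at `y` from the base station at `x` over a reflected link (a link with a
reflection path and no line-of-sight path) of length at most `r` -/
def refPower (ω : Ω) (x y : Plane) : ℝ :=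
  if dist x y ≤ p.r ∧ (N.env ω, x, y) ∈ N.ref \ N.los then
    p.Pt * p.meanGain * p.pathLoss p.αN (dist x y) * p.ρ else 0

open scoped Classical in
/-- The random aggregate powers, summed over all eavesdroppers in range of the typical base
station, and for `iCross` over all other base stations in range of the eavesdropper. -/
def powers (ω : Ω) : Powers where
  sLos := ∑' y : N.eve ω, (1 - p.η) * N.losPower ω 0 y
  sRef := ∑' y : N.eve ω, (1 - p.η) * N.refPower ω 0 y
  iLos := ∑' y : N.eve ω, p.η * N.losPower ω 0 y
  iRef := ∑' y : N.eve ω, p.η * N.refPower ω 0 y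
  iCross := ∑' y : N.eve ω, ∑' x : N.bs ω,
    if dist (0 : Plane) y ≤ p.r then N.losPower ω x y + N.refPower ω x y else 0

/-- SINR of the colluding eavesdroppers -/
def sinr (ω : Ω) : ℝ := (N.powers ω).sinr p.noise

/-- eavesdropping success probability of the colluding eavesdroppers at threshold `β` -/
def esp (β : ℝ) : ℝ≥0∞ := μ {ω | β < N.sinr ω}

/-- the information on the geometry of the typical link -/
abbrev geometry : MeasurableSpace Ω :=
  MeasurableSpace.comap
    (fun ω => (N.d (N.env ω), N.D (N.env ω), N.τ (N.env ω), N.θ (N.env ω))) inferInstance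

/-- the aggregate powers, each replaced by its mean given the geometry of the typical link -/
def meanPowers (ω : Ω) : Powers where
  sLos := (μ[fun ω' => (N.powers ω').sLos | N.geometry]) ω
  sRef := (μ[fun ω' => (N.powers ω').sRef | N.geometry]) ω
  iLos := (μ[fun ω' => (N.powers ω').iLos | N.geometry]) ω
  iRef := (μ[fun ω' => (N.powers ω').iRef | N.geometry]) ω
  iCross := (μ[fun ω' => (N.powers ω').iCross | N.geometry]) ω

/-- the SINR with the aggregate powers replaced by their means and the noise neglected -/
def approxSinr (ω : Ω) : ℝ := (N.meanPowers ω).sinr 0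

/-- the approximate eavesdropping success probability of the colluding eavesdroppers -/
def approxEsp (β : ℝ) : ℝ≥0∞ := μ {ω | β < N.approxSinr ω}

/-- `P_Los` of the (random) typical link -/
def PLos (ω : Ω) : ℝ := p.pLos (N.d (N.env ω))

/-- `P_Ref` of the (random) typical link -/
def PRef (ω : Ω) : ℝ := p.pRef (N.D (N.env ω)) (N.τ (N.env ω)) (N.θ (N.env ω))

end Network

end MmWave

end

noncomputable section

namespace MmWave

/-! Given the geometry, let M be the mean power received by the eavesdroppers from the typical base
station before time switching (`meanLos + meanRef`). The signal has mean (1 - η)M and the typical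
station's own interference has mean ηM. By translation invariance, each eavesdropper in range
receives from the other stations, on average, the disc integral of the path loss times λ_b and the
link probabilities. The eavesdroppers in range number π r² λ_e on average, so the cross interference
has mean π r² λ_b M. Thus M cancels from the approximate SINR wherever M > 0, just as B cancels from
the claimed quotient. This is why the quotient is right even when B is not proportional to M. For d₀
= 0, polar coordinates show that M is a constant times B.

The means come from Campbell's formula (`campbell`), applied once for the signal
(`setLIntegral_signal`) and twice for the cross interference (`setLIntegral_crossSum`). Its mark is
the environment, so integrating over events of the geometry identifies conditional expectations
(`condExp_toReal`). Fubini needs an s-finite kernel that reproduces each locally finite measure.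
`locFinKernel` is built for this by cutting measures into pieces of bounded mass. -/

/-! ### Mean of the Poisson law -/

/-- The factor n + 1 cancels against the factorial, which shifts the mass at n + 1 to r times the
mass at n. The total mass is 1. -/
lemma lintegral_natCast_poissonMeasure (r : ℝ≥0) :
    ∫⁻ n, (n : ℝ≥0∞) ∂poissonMeasure r = r := by
  have hmass : ∑' n : ℕ, poissonMeasure r {n} = 1 := by
    have := lintegral_countable' (μ := poissonMeasure r) (fun _ : ℕ => (1 : ℝ≥0∞))
    simpa using this.symm
  rw [lintegral_countable', tsum_eq_zero_add' ENNReal.summable]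
  have step : ∀ n : ℕ, ((n + 1 : ℕ) : ℝ≥0∞) * poissonMeasure r {n + 1} =
      r * poissonMeasure r {n} := by
    intro n
    rw [poissonMeasure_singleton, poissonMeasure_singleton, ← ENNReal.ofReal_natCast,
      ← ENNReal.ofReal_coe_nnreal, ← ENNReal.ofReal_mul (by positivity),
      ← ENNReal.ofReal_mul (by positivity)]
    congr 1
    rw [Nat.factorial_succ]
    push_cast
    have : ((n : ℝ) + 1) ≠ 0 := by positivity
    have : (n.factorial : ℝ) ≠ 0 := by positivity
    field_simp
    ring
  simp_rw [step, ENNReal.tsum_mul_left, hmass]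
  simp

/-! ### An s-finite kernel that reproduces locally finite measures -/

/-- The annuli `n - 1 < ‖x‖ ≤ n` (for `n = 0` the origin). -/
def annulus (n : ℕ) : Set Plane := disjointed (fun m : ℕ => Metric.closedBall (0 : Plane) m) n

lemma measurableSet_annulus (n : ℕ) : MeasurableSet (annulus n) :=
  MeasurableSet.disjointed (fun _ => measurableSet_closedBall) n

lemma annulus_subset (n : ℕ) : annulus n ⊆ Metric.closedBall 0 n := disjointed_subset _ n

lemma sum_restrict_annulus (ν : Measure Plane) :
    Measure.sum (fun n => ν.restrict (annulus n)) = ν := by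
  have h : ⋃ n, annulus n = univ := by
    rw [show (⋃ n, annulus n) = ⋃ n : ℕ, Metric.closedBall (0 : Plane) n from iUnion_disjointed]
    exact iUnion_eq_univ_iff.2 fun x => by simpa using exists_nat_ge ‖x‖
  rw [← Measure.restrict_iUnion (μ := ν) (s := annulus)
    (disjoint_disjointed _) measurableSet_annulus, h,
    Measure.restrict_univ]

/-- The measures whose mass on the `n`-th annulus is in `[m, m + 1)`. -/
def annulusMassSet (n m : ℕ) : Set (Measure Plane) :=
  {ν | (m : ℝ≥0∞) ≤ ν (annulus n) ∧ ν (annulus n) < (m + 1 : ℝ≥0∞)}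

lemma measurableSet_annulusMassSet (n m : ℕ) : MeasurableSet (annulusMassSet n m) :=
  (measurableSet_le measurable_const (Measure.measurable_coe (measurableSet_annulus n))).inter
    (measurableSet_lt (Measure.measurable_coe (measurableSet_annulus n)) measurable_const)

open scoped Classical in
/-- The finite kernel restricting a measure to the `n`-th annulus if its mass there is in
`[m, m + 1)`, and sending it to `0` otherwise. -/
def annulusKernel (n m : ℕ) : Kernel (Measure Plane) Plane :=
  Kernel.piecewise (measurableSet_annulusMassSet n m)
    (Kernel.restrict ⟨id, measurable_id⟩ (measurableSet_annulus n)) 0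

open scoped Classical in
lemma annulusKernel_apply (n m : ℕ) (ν : Measure Plane) :
    annulusKernel n m ν = if ν ∈ annulusMassSet n m then ν.restrict (annulus n) else 0 := rfl

instance (n m : ℕ) : IsFiniteKernel (annulusKernel n m) := by
  refine ⟨⟨m + 1, by finiteness, fun ν => ?_⟩⟩
  rw [annulusKernel_apply]
  split_ifs with h
  · simpa using h.2.le
  · simp

/-- The s-finite kernel sending a locally finite measure on the plane to itself. -/
def locFinKernel : Kernel (Measure Plane) Plane :=
  Kernel.sum fun n : ℕ => Kernel.sum fun m : ℕ => annulusKernel n m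

instance : IsSFiniteKernel locFinKernel :=
  Kernel.isSFiniteKernel_sum (hκs := fun _ => Kernel.isSFiniteKernel_sum (hκs := inferInstance))

/-- On each annulus exactly one index m is active, the integer part of the finite mass there. The
double sum therefore collapses to the sum of the restrictions of ν to the annuli. -/
lemma locFinKernel_apply {ν : Measure Plane} (h : ∀ n, ν (annulus n) ≠ ∞) :
    locFinKernel ν = ν := by
  have hfl : ∀ n, ∃ m : ℕ, ∀ k : ℕ,
      ν ∈ annulusMassSet n k ↔ k = m := by
    intro n
    refine ⟨⌊(ν (annulus n)).toNNReal⌋₊, fun k => ?_⟩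
    rw [eq_comm, Nat.floor_eq_iff (by positivity), annulusMassSet, mem_ofPred_eq]
    lift ν (annulus n) to ℝ≥0 using h n with x
    norm_cast
  conv_rhs => rw [← sum_restrict_annulus ν]
  ext S hS
  rw [locFinKernel, Kernel.sum_apply' _ _ hS, Measure.sum_apply _ hS]
  refine tsum_congr fun n => ?_
  obtain ⟨m, hm⟩ := hfl n
  simp only [Kernel.sum_apply' _ _ hS, annulusKernel_apply, hm]
  rw [tsum_eq_single m]
  · simp
  · intro k hk
    simp [hk]

/-! ### Intensity measure and Campbell's formula -/

section PointProcess

variable {Ω : Type*} [MeasurableSpace Ω] {μ : Measure Ω} {Φ : Ω → Set Plane} {lam : ℝ≥0}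

namespace IsHPPP

lemma inter_finite (h : IsHPPP μ Φ lam) (ω : Ω) {A : Set Plane} (hA : Bornology.IsBounded A) :
    (Φ ω ∩ A).Finite := by
  obtain ⟨R, hR⟩ := hA.subset_closedBall 0
  exact (h.locallyFinite ω R).subset (inter_subset_inter_right _ hR)

lemma countable (h : IsHPPP μ Φ lam) (ω : Ω) : (Φ ω).Countable := by
  have : Φ ω = ⋃ n : ℕ, Φ ω ∩ Metric.closedBall 0 n := by
    rw [← inter_iUnion, iUnion_eq_univ_iff.2 fun x => by simpa using exists_nat_ge ‖x‖,
      inter_univ]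
  rw [this]
  exact countable_iUnion fun n => (h.locallyFinite ω n).countable

lemma pointMeasure_apply (h : IsHPPP μ Φ lam) (ω : Ω) {A : Set Plane} (hA : MeasurableSet A)
    (hb : Bornology.IsBounded A) : pointMeasure (Φ ω) A = ((Φ ω ∩ A).ncard : ℝ≥0∞) := by
  rw [pointMeasure, Measure.restrict_apply hA, inter_comm,
    Measure.count_apply_finite _ (h.inter_finite ω hb), ncard_eq_toFinset_card _
      (h.inter_finite ω hb)]

lemma locFinKernel_pointMeasure (h : IsHPPP μ Φ lam) (ω : Ω) :
    locFinKernel (pointMeasure (Φ ω)) = pointMeasure (Φ ω) := by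
  refine locFinKernel_apply fun n => ?_
  rw [h.pointMeasure_apply ω (measurableSet_annulus n)
    (Metric.isBounded_closedBall.subset (annulus_subset n))]
  finiteness

lemma lintegral_pointMeasure (h : IsHPPP μ Φ lam) (ω : Ω) (f : Plane → ℝ≥0∞) :
    ∫⁻ y, f y ∂pointMeasure (Φ ω) = ∑' y : Φ ω, f y := by
  rw [pointMeasure, lintegral_countable _ (h.countable ω)]
  simp

/-- The intensity measure of a homogeneous Poisson point process on bounded sets. -/
lemma lintegral_pointMeasure_apply (h : IsHPPP μ Φ lam) [IsProbabilityMeasure μ]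
    {A : Set Plane} (hA : MeasurableSet A) (hb : Bornology.IsBounded A) :
    ∫⁻ ω, pointMeasure (Φ ω) A ∂μ = lam * volume A := by
  have hm : AEMeasurable (fun ω => (Φ ω ∩ A).ncard) μ := by
    -- The count must be a.e. measurable: otherwise its image measure is 0 by convention, which is
    -- not a Poisson law.
    by_contra hn
    have h1 := h.law A hA hb
    rw [Measure.map_of_not_aemeasurable hn] at h1
    have := IsProbabilityMeasure.ne_zero (poissonMeasure (lam * (volume A).toNNReal))
    exact this h1.symm
  simp_rw [h.pointMeasure_apply _ hA hb]
  rw [← lintegral_map' (f := fun n : ℕ => (n : ℝ≥0∞)) (by fun_prop) hm, h.law A hA hb,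
    lintegral_natCast_poissonMeasure]
  push_cast
  rw [ENNReal.coe_toNNReal hb.measure_lt_top.ne]

/-- The Poisson law gives the intensity on bounded sets only, so the two measures are compared
annulus by annulus. -/
lemma bind_locFinKernel (h : IsHPPP μ Φ lam) [IsProbabilityMeasure μ] :
    (μ.map fun ω => pointMeasure (Φ ω)).bind locFinKernel = lam • volume := by
  rw [← sum_restrict_annulus ((μ.map fun ω => pointMeasure (Φ ω)).bind locFinKernel),
    ← sum_restrict_annulus (lam • volume)]
  congr 1
  ext n S hS
  rw [Measure.restrict_apply hS, Measure.restrict_apply hS]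
  have hm := hS.inter (measurableSet_annulus n)
  rw [Measure.bind_apply hm (Kernel.aemeasurable _),
    lintegral_map (Kernel.measurable_coe _ hm) h.measurable]
  simp_rw [h.locFinKernel_pointMeasure]
  rw [h.lintegral_pointMeasure_apply hm ((Metric.isBounded_closedBall.subset
    (annulus_subset n)).subset inter_subset_right)]
  rfl

variable {X : Type*} [MeasurableSpace X]

lemma measurable_lintegral_locFinKernel {f : X × Plane → ℝ≥0∞} (hf : Measurable f) :
    Measurable fun z : X × Measure Plane => ∫⁻ y, f (z.1, y) ∂locFinKernel z.2 :=
  Measurable.lintegral_kernel_prod_right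
    (κ := locFinKernel.comap Prod.snd (measurable_snd : Measurable (Prod.snd : X × _ → _)))
    (f := fun z y => f (z.1, y)) (by fun_prop)

/-- Campbell's formula, with an independent mark. -/
lemma campbell (h : IsHPPP μ Φ lam) [IsProbabilityMeasure μ] {ξ : Ω → X} (hξ : Measurable ξ)
    (hind : IndepFun ξ (fun ω => pointMeasure (Φ ω)) μ) {f : X × Plane → ℝ≥0∞}
    (hf : Measurable f) :
    ∫⁻ ω, ∫⁻ y, f (ξ ω, y) ∂locFinKernel (pointMeasure (Φ ω)) ∂μ =
      lam * ∫⁻ y, ∫⁻ ω, f (ξ ω, y) ∂μ := by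
  -- Independence makes the joint law a product. The mark can then be frozen while the process is
  -- averaged to its intensity measure.
  have hp := (indepFun_iff_map_prod_eq_prod_map_map hξ.aemeasurable
    h.measurable.aemeasurable).1 hind
  have hF := measurable_lintegral_locFinKernel hf
  have := Measure.isProbabilityMeasure_map (μ := μ) hξ.aemeasurable
  have := Measure.isProbabilityMeasure_map (μ := μ) h.measurable.aemeasurable
  calc _ = ∫⁻ z, ∫⁻ y, f (z.1, y) ∂locFinKernel z.2
        ∂(μ.map fun ω => (ξ ω, pointMeasure (Φ ω))) :=
        (lintegral_map hF (hξ.prodMk h.measurable)).symm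
    _ = ∫⁻ x, ∫⁻ ν, ∫⁻ y, f (x, y) ∂locFinKernel ν ∂(μ.map fun ω => pointMeasure (Φ ω))
        ∂(μ.map ξ) := by rw [hp, lintegral_prod _ hF.aemeasurable]
    _ = ∫⁻ x, lam * ∫⁻ y, f (x, y) ∂volume ∂(μ.map ξ) := by
        refine lintegral_congr fun x => ?_
        have hfx : Measurable fun y => f (x, y) := by fun_prop
        rw [← Measure.lintegral_bind (Kernel.aemeasurable _) hfx.aemeasurable,
          h.bind_locFinKernel, lintegral_smul_measure]
        rfl
    _ = lam * ∫⁻ x, ∫⁻ y, f (x, y) ∂volume ∂(μ.map ξ) :=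
        lintegral_const_mul _ hf.lintegral_prod_right'
    _ = lam * ∫⁻ ω, ∫⁻ y, f (ξ ω, y) ∂volume ∂μ := by
        rw [lintegral_map hf.lintegral_prod_right' hξ]
    _ = _ := by
        rw [lintegral_lintegral_swap (by fun_prop)]

/-- Campbell's formula, on an event that depends on the mark. -/
lemma setLIntegral_campbell (h : IsHPPP μ Φ lam) [IsProbabilityMeasure μ] {ξ : Ω → X}
    (hξ : Measurable ξ) (hind : IndepFun ξ (fun ω => pointMeasure (Φ ω)) μ)
    {f : X × Plane → ℝ≥0∞} (hf : Measurable f) {B : Set X} (hB : MeasurableSet B) :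
    ∫⁻ ω in ξ ⁻¹' B, ∫⁻ y, f (ξ ω, y) ∂locFinKernel (pointMeasure (Φ ω)) ∂μ =
      lam * ∫⁻ y, ∫⁻ ω in ξ ⁻¹' B, f (ξ ω, y) ∂μ := by
  have key := h.campbell hξ hind (hf.indicator (measurable_fst hB))
  simp only [indicator, mem_preimage] at key
  rw [← lintegral_indicator (hξ hB)]
  simp_rw [← lintegral_indicator (hξ hB)]
  convert key using 3 with ω
  · by_cases hω : ξ ω ∈ B <;> simp [indicator, hω]
  · rfl

end IsHPPP

end PointProcess

/-! ### Conditional expectations from Lebesgue integrals over events -/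

/-- Taking A to be the whole space bounds the integral of X by that of q, so X is a.e. finite and
integrable. The other A characterise the conditional expectation. -/
lemma condExp_toReal {Ω : Type*} {m m₀ : MeasurableSpace Ω} {μ : Measure Ω}
    [IsFiniteMeasure μ] (hm : m ≤ m₀) {X : Ω → ℝ≥0∞} (hX : Measurable X) {q : Ω → ℝ}
    (hqm : Measurable[m] q) (hq0 : 0 ≤ᵐ[μ] q) (hqi : Integrable q μ)
    (h : ∀ A, MeasurableSet[m] A → ∫⁻ ω in A, X ω ∂μ = ∫⁻ ω in A, ENNReal.ofReal (q ω) ∂μ) :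
    Integrable (fun ω => (X ω).toReal) μ ∧ μ[fun ω => (X ω).toReal | m] =ᵐ[μ] q := by
  have htop : ∫⁻ ω, X ω ∂μ ≠ ∞ := by
    rw [← setLIntegral_univ, h _ MeasurableSet.univ, setLIntegral_univ]
    exact hqi.lintegral_lt_top.ne
  have hint := integrable_toReal_of_lintegral_ne_top hX.aemeasurable htop
  refine ⟨hint, (ae_eq_condExp_of_forall_setIntegral_eq hm hint (fun _ _ _ => hqi.integrableOn)
    (fun A hA _ => ?_) hqm.stronglyMeasurable.aestronglyMeasurable).symm⟩
  rw [integral_toReal hX.aemeasurable (ae_restrict_of_ae (ae_lt_top hX htop)), h A hA,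
    integral_eq_lintegral_of_nonneg_ae (ae_restrict_of_ae hq0)
      hqi.aestronglyMeasurable.restrict]

/-! ### Mean gain and integrals of the path loss -/

namespace Params

variable (p : Params)

/-- The truncation confines the misalignment to the main lobe, so the side lobe is never seen. -/
lemma meanGain_eq : p.meanGain = p.Gm := by
  have hS : MeasurableSet (Icc 0 (p.beamwidth / 2)) := measurableSet_Icc
  have hv : p.misVar ≠ 0 := p.misVar_pos.ne'
  have hpos : gaussianReal 0 p.misVar (Icc 0 (p.beamwidth / 2)) ≠ 0 := by
    intro h0
    have := gaussianReal_absolutelyContinuous' 0 hv h0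
    rw [Real.volume_Icc, ENNReal.ofReal_eq_zero] at this
    linarith [p.beamwidth_pos]
  have : IsProbabilityMeasure p.misalignmentLaw := cond_isProbabilityMeasure hpos
  have hae : ∀ᵐ ω ∂p.misalignmentLaw, p.sectorGain ω = p.Gm := by
    have : ∀ᵐ ω ∂p.misalignmentLaw, ω ∈ Icc 0 (p.beamwidth / 2) := ae_cond_mem hS
    filter_upwards [this] with ω hω
    simp [sectorGain, hω.2]
  rw [meanGain, integral_congr_ae hae]
  simp

lemma meanGain_pos : 0 < p.meanGain := p.meanGain_eq ▸ p.Gm_pos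

lemma measurable_pathLoss (α : ℝ) : Measurable (p.pathLoss α) := by
  unfold pathLoss
  fun_prop

lemma pathLoss_nonneg (α x : ℝ) : 0 ≤ p.pathLoss α x :=
  mul_nonneg p.b_pos.le (Real.rpow_nonneg (le_max_of_le_left p.dref_nonneg) _)

lemma pathLoss_pos (α : ℝ) {x : ℝ} (hx : 0 < x) : 0 < p.pathLoss α x :=
  mul_pos p.b_pos (Real.rpow_pos_of_pos (lt_max_of_lt_right hx) _)

/-- The integral of the path loss over the disc of radius `r`. -/
def rangeLoss (α : ℝ) : ℝ := ∫ x in Metric.closedBall (0 : Plane) p.r, p.pathLoss α ‖x‖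

/-- Polar coordinates: 2 is the dimension and π the area of the unit disc. -/
lemma setIntegral_closedBall_norm (f : ℝ → ℝ) (r : ℝ) :
    ∫ x in Metric.closedBall (0 : Plane) r, f ‖x‖ =
      2 * Real.pi * ∫ y in Ioc 0 r, y * f y := by
  have h1 : ∀ x : Plane, (Metric.closedBall (0 : Plane) r).indicator (fun x => f ‖x‖) x =
      (Iic r).indicator f ‖x‖ := fun x => by simp [indicator]
  rw [← integral_indicator measurableSet_closedBall]
  simp_rw [h1]
  rw [integral_fun_norm_addHaar volume ((Iic r).indicator f)]
  have h2 : (fun y : ℝ => y ^ (Module.finrank ℝ Plane - 1) • (Iic r).indicator f y) =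
      (Iic r).indicator fun y => y * f y := by
    ext y
    by_cases hy : y ≤ r <;> simp [indicator, hy]
  rw [h2, setIntegral_indicator measurableSet_Iic, Ioi_inter_Iic]
  simp [Measure.real, ENNReal.toReal_ofReal Real.pi_nonneg, mul_assoc]

lemma integrableOn_closedBall_norm {f : ℝ → ℝ} {r : ℝ}
    (hf : IntegrableOn (fun y => y * f y) (Ioc 0 r)) :
    IntegrableOn (fun x => f ‖x‖) (Metric.closedBall (0 : Plane) r) := by
  have h1 : (Metric.closedBall (0 : Plane) r).indicator (fun x => f ‖x‖) =
      fun x => (Iic r).indicator f ‖x‖ := by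
    ext x
    simp [indicator]
  rw [← integrable_indicator_iff measurableSet_closedBall, h1,
    integrable_fun_norm_addHaar volume (f := (Iic r).indicator f)]
  have h2 : (fun y : ℝ => y ^ (Module.finrank ℝ Plane - 1) • (Iic r).indicator f y) =
      (Iic r).indicator fun y => y * f y := by
    ext y
    by_cases hy : y ≤ r <;> simp [indicator, hy]
  rw [h2, IntegrableOn, integrable_indicator_iff measurableSet_Iic, IntegrableOn,
    Measure.restrict_restrict measurableSet_Iic, inter_comm, Ioi_inter_Iic]
  exact hf

lemma mul_pathLoss_of_dref_eq_zero (h0 : p.dref = 0) (α : ℝ) {y : ℝ} (hy : 0 < y) :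
    y * p.pathLoss α y = p.b * y ^ (1 - α) := by
  rw [pathLoss, h0, max_eq_right hy.le, sub_eq_add_neg, Real.rpow_add hy, Real.rpow_one]
  ring

/-- A positive reference distance bounds the path loss. Without one, the radial density is a
multiple of y ^ (1 - α), integrable at 0 because α < 2. -/
lemma integrableOn_pathLoss {α : ℝ} (h : 0 < p.dref ∨ α < 2) (hα : 0 < α) :
    IntegrableOn (fun x : Plane => p.pathLoss α ‖x‖) (Metric.closedBall 0 p.r) := by
  rcases p.dref_nonneg.lt_or_eq with hd | hd
  · refine Measure.integrableOn_of_bounded (M := p.b * p.dref ^ (-α))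
      measure_closedBall_lt_top.ne
      ((p.measurable_pathLoss α).comp measurable_norm).aestronglyMeasurable ?_
    refine Filter.Eventually.of_forall fun x => ?_
    rw [Real.norm_of_nonneg (p.pathLoss_nonneg _ _)]
    exact mul_le_mul_of_nonneg_left
      (Real.rpow_le_rpow_of_nonpos hd (le_max_left _ _) (by linarith)) p.b_pos.le
  · have hα2 : α < 2 := h.resolve_left (by rw [← hd]; exact lt_irrefl _)
    refine integrableOn_closedBall_norm ?_
    rw [integrableOn_congr_fun (fun y hy => p.mul_pathLoss_of_dref_eq_zero hd.symm α hy.1)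
      measurableSet_Ioc]
    have := (intervalIntegral.intervalIntegrable_rpow' (a := 0) (b := p.r)
      (show -1 < 1 - α by linarith)).const_mul p.b
    exact (intervalIntegrable_iff_integrableOn_Ioc_of_le p.r_pos.le).1 this

lemma rangeLoss_pos {α : ℝ} (h : 0 < p.dref ∨ α < 2) (hα : 0 < α) : 0 < p.rangeLoss α := by
  rw [rangeLoss, setIntegral_pos_iff_support_of_nonneg_ae
    (Filter.Eventually.of_forall fun x => p.pathLoss_nonneg _ _) (p.integrableOn_pathLoss h hα)]
  -- The centre is removed because for `dref = 0` the convention `0 ^ (-α) = 0` makes the path loss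
  -- vanish there.
  have hsub : Metric.ball (0 : Plane) p.r \ {0} ⊆
      Function.support (fun x : Plane => p.pathLoss α ‖x‖) ∩ Metric.closedBall 0 p.r :=
    fun x hx => ⟨(p.pathLoss_pos α (norm_pos_iff.2 hx.2)).ne', Metric.ball_subset_closedBall hx.1⟩
  refine lt_of_lt_of_le ?_ (measure_mono hsub)
  rw [measure_sdiff_null (measure_singleton _)]
  exact Metric.measure_ball_pos _ _ p.r_pos

lemma rangeLoss_of_dref_eq_zero {α : ℝ} (h0 : p.dref = 0) (hα : α < 2) :
    p.rangeLoss α = Real.pi * p.r ^ 2 * p.b * (2 / (p.r ^ α * (2 - α))) := by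
  rw [rangeLoss, setIntegral_closedBall_norm, setIntegral_congr_fun measurableSet_Ioc
    (fun y hy => p.mul_pathLoss_of_dref_eq_zero h0 α hy.1),
    ← intervalIntegral.integral_of_le p.r_pos.le, intervalIntegral.integral_const_mul,
    integral_rpow (Or.inl (by linarith)), Real.zero_rpow (by linarith),
    show 1 - α + 1 = 2 - α by ring, Real.rpow_sub p.r_pos, Real.rpow_two]
  have : p.r ^ α ≠ 0 := (Real.rpow_pos_of_pos p.r_pos _).ne'
  have : 2 - α ≠ 0 := by linarith
  field_simp
  ring

lemma lintegral_rangeLoss {α : ℝ} (h : 0 < p.dref ∨ α < 2) (hα : 0 < α) {a : ℝ} (ha : 0 ≤ a) :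
    ∫⁻ x : Plane, (if ‖x‖ ≤ p.r then ENNReal.ofReal (a * p.pathLoss α ‖x‖) else 0) =
      ENNReal.ofReal (a * p.rangeLoss α) := by
  have h1 : ∀ x : Plane, (if ‖x‖ ≤ p.r then ENNReal.ofReal (a * p.pathLoss α ‖x‖) else 0) =
      (Metric.closedBall 0 p.r).indicator (fun x => ENNReal.ofReal (a * p.pathLoss α ‖x‖)) x :=
    fun x => by simp [indicator]
  simp_rw [h1]
  rw [lintegral_indicator measurableSet_closedBall, rangeLoss, ← integral_const_mul,
    ofReal_integral_eq_lintegral_ofReal ((p.integrableOn_pathLoss h hα).const_mul a)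
      (Filter.Eventually.of_forall fun x => mul_nonneg ha (p.pathLoss_nonneg _ _))]

end Params

/-! ### Link probabilities and link weights -/

lemma measure_inter_of_condExp_indicator {Ω : Type*} {m m₀ : MeasurableSpace Ω} {μ : Measure Ω}
    [IsFiniteMeasure μ] (hm : m ≤ m₀) {T : Set Ω} (hT : MeasurableSet T) {q : Ω → ℝ}
    (h : μ[T.indicator (fun _ => (1 : ℝ)) | m] =ᵐ[μ] q) {A : Set Ω} (hA : MeasurableSet[m] A) :
    μ (A ∩ T) = ∫⁻ ω in A, ENNReal.ofReal (q ω) ∂μ := by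
  have hint : Integrable (T.indicator (fun _ => (1 : ℝ))) μ :=
    (integrable_const 1).indicator hT
  have hq0 : 0 ≤ᵐ[μ] q := by
    filter_upwards [h, condExp_nonneg (m := m) (μ := μ) (f := T.indicator (fun _ => (1 : ℝ)))
      (Filter.Eventually.of_forall fun ω => indicator_nonneg (fun _ _ => zero_le_one) ω)]
      with ω h1 h2
    rw [← h1]
    exact h2
  have hqi : Integrable q μ := integrable_condExp.congr h
  rw [← ofReal_integral_eq_lintegral_ofReal hqi.integrableOn (ae_restrict_of_ae hq0),
    ← setIntegral_congr_ae (hm A hA) (h.mono fun ω hω _ => hω), setIntegral_condExp hm hint hA,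
    setIntegral_indicator hT, setIntegral_const, smul_eq_mul, mul_one, ofReal_measureReal]

lemma Params.measurable_pLos (p : Params) : Measurable p.pLos := by
  unfold Params.pLos
  fun_prop

lemma Params.measurable_pRef (p : Params) :
    Measurable fun z : ℝ × ℝ × ℝ => p.pRef z.1 z.2.1 z.2.2 := by
  unfold Params.pRef
  fun_prop

/-- The power received over a link in `S` of length at most `r`, as an extended nonnegative real:
`a` times the path loss. -/
def linkWeight {E : Type*} (p : Params) (S : Set (E × Plane × Plane)) (α a : ℝ) :
    E × Plane × Plane → ℝ≥0∞ :=
  S.indicator fun z => if dist z.2.1 z.2.2 ≤ p.r then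
    ENNReal.ofReal (a * p.pathLoss α (dist z.2.1 z.2.2)) else 0

lemma measurable_linkWeight {E : Type*} [MeasurableSpace E] (p : Params)
    {S : Set (E × Plane × Plane)} (hS : MeasurableSet S) (α a : ℝ) :
    Measurable (linkWeight p S α a) := by
  have hd : Measurable fun z : E × Plane × Plane => dist z.2.1 z.2.2 :=
    (measurable_fst.comp measurable_snd).dist (measurable_snd.comp measurable_snd)
  exact (Measurable.ite (measurableSet_le hd measurable_const)
    (((p.measurable_pathLoss α).comp hd).const_mul a).ennreal_ofReal measurable_const).indicator hS

lemma linkWeight_ne_top {E : Type*} (p : Params) (S : Set (E × Plane × Plane)) (α a : ℝ)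
    (z : E × Plane × Plane) : linkWeight p S α a z ≠ ∞ := by
  unfold linkWeight indicator
  split_ifs <;> finiteness

lemma linkWeight_of_lt {E : Type*} (p : Params) (S : Set (E × Plane × Plane)) (α a : ℝ)
    {z : E × Plane × Plane} (h : p.r < dist z.2.1 z.2.2) : linkWeight p S α a z = 0 := by
  simp [linkWeight, indicator, h.not_ge]

/-! ### Links given the geometry, and the mean signal -/

namespace Network

variable {p : Params} {Ω E : Type*} [MeasurableSpace Ω] [MeasurableSpace E] {μ : Measure Ω}
  (N : Network p E μ)

/-- The geometry of the typical link as a function of the environment. -/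
def geom (e : E) : ℝ × ℝ × ℝ × ℝ := (N.d e, N.D e, N.τ e, N.θ e)

lemma measurable_geom : Measurable N.geom :=
  N.d_measurable.prodMk (N.D_measurable.prodMk (N.τ_measurable.prodMk N.θ_measurable))

lemma geometry_le : N.geometry ≤ ‹MeasurableSpace Ω› :=
  (N.measurable_geom.comp N.env_measurable).comap_le

lemma exists_env_preimage {A : Set Ω} (hA : MeasurableSet[N.geometry] A) :
    ∃ B : Set E, MeasurableSet B ∧ A = N.env ⁻¹' B := by
  obtain ⟨T, hT, rfl⟩ := hA
  exact ⟨N.geom ⁻¹' T, N.measurable_geom hT, rfl⟩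

lemma measurable_PLos : Measurable[N.geometry] N.PLos := by
  have hg : Measurable[N.geometry] fun ω => N.geom (N.env ω) := comap_measurable _
  exact p.measurable_pLos.comp (measurable_fst.comp hg)

lemma measurable_PRef : Measurable[N.geometry] N.PRef := by
  have hg : Measurable[N.geometry] fun ω => N.geom (N.env ω) := comap_measurable _
  have he : N.PRef = (fun z : ℝ × ℝ × ℝ => p.pRef z.1 z.2.1 z.2.2) ∘
      fun ω => (N.geom (N.env ω)).2 := by
    ext ω
    simp only [PRef, geom, Function.comp_apply]
  rw [he]
  exact p.measurable_pRef.comp (measurable_snd.comp hg)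

lemma PLos_pos (ω : Ω) : 0 < N.PLos ω := Real.exp_pos _

lemma PRef_pos (ω : Ω) : 0 < N.PRef ω := Real.exp_pos _

/-- The links in `S` exist with conditional probability `q` given the geometry. -/
def HasLinkProb (S : Set (E × Plane × Plane)) (q : Ω → ℝ) : Prop :=
  ∀ x y : Plane, x ≠ y → ∀ A, MeasurableSet[N.geometry] A →
    μ (A ∩ {ω | (N.env ω, x, y) ∈ S}) = ∫⁻ ω in A, ENNReal.ofReal (q ω) ∂μ

lemma measurableSet_link {S : Set (E × Plane × Plane)} (hS : MeasurableSet S) (x y : Plane) :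
    MeasurableSet {ω | (N.env ω, x, y) ∈ S} :=
  (N.env_measurable.prodMk measurable_const) hS

lemma indep_env_eve : IndepFun N.env (fun ω => pointMeasure (N.eve ω)) μ :=
  N.indep_env.comp measurable_id measurable_snd

lemma indep_env_bs : IndepFun N.env (fun ω => pointMeasure (N.bs ω)) μ :=
  N.indep_env.comp measurable_id measurable_fst

variable {S : Set (E × Plane × Plane)} {q : Ω → ℝ}

/-- For fixed endpoints the path loss is deterministic; only the existence of the link is random. -/
lemma setLIntegral_linkWeight (hq : N.HasLinkProb S q) (hS : MeasurableSet S) (α a : ℝ)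
    {x y : Plane} (hxy : x ≠ y) {A : Set Ω} (hA : MeasurableSet[N.geometry] A) :
    ∫⁻ ω in A, linkWeight p S α a (N.env ω, x, y) ∂μ =
      (if ‖x - y‖ ≤ p.r then ENNReal.ofReal (a * p.pathLoss α ‖x - y‖) else 0) *
        ∫⁻ ω in A, ENNReal.ofReal (q ω) ∂μ := by
  have hm := N.measurableSet_link hS x y
  have he : ∀ ω, linkWeight p S α a (N.env ω, x, y) =
      {ω | (N.env ω, x, y) ∈ S}.indicator (fun _ => if ‖x - y‖ ≤ p.r then
        ENNReal.ofReal (a * p.pathLoss α ‖x - y‖) else 0) ω := by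
    intro ω
    simp only [linkWeight, indicator, dist_eq_norm, mem_ofPred_eq]
  simp_rw [he]
  rw [lintegral_indicator hm, setLIntegral_const, Measure.restrict_apply hm, inter_comm,
    hq x y hxy A hA]

section Probability

variable [IsProbabilityMeasure μ]

/-- The exponential formulas do not show that `PLos` and `PRef` are at most 1. The bound holds
because they are conditional probabilities, and one pair of distinct points suffices to get it. -/
lemma le_one_of_condExp (hS : MeasurableSet S) {x y : Plane}
    (h : μ[{ω | (N.env ω, x, y) ∈ S}.indicator (fun _ => (1 : ℝ)) | N.geometry]
      =ᵐ[μ] q) : ∀ᵐ ω ∂μ, q ω ≤ 1 := by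
  have h1 : μ[{ω | (N.env ω, x, y) ∈ S}.indicator (fun _ => (1 : ℝ)) | N.geometry]
      ≤ᵐ[μ] μ[fun _ => (1 : ℝ) | N.geometry] :=
    condExp_mono ((integrable_const 1).indicator (N.measurableSet_link hS x y))
      (integrable_const 1)
      (Filter.Eventually.of_forall fun ω => indicator_le_self' (fun _ _ => zero_le_one) ω)
  rw [condExp_const N.geometry_le] at h1
  filter_upwards [h, h1] with ω h2 h3
  rw [← h2]
  exact h3

lemma PLos_le_one : ∀ᵐ ω ∂μ, N.PLos ω ≤ 1 := by
  obtain ⟨y, hy⟩ := exists_ne (0 : Plane)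
  exact N.le_one_of_condExp N.los_measurable (N.los_prob 0 y hy.symm)

lemma PRef_le_one : ∀ᵐ ω ∂μ, N.PRef ω ≤ 1 := by
  obtain ⟨y, hy⟩ := exists_ne (0 : Plane)
  exact N.le_one_of_condExp N.ref_measurable (N.ref_prob 0 y hy.symm)

/-- The indicator of S \ T is that of S minus that of S ∩ T, and conditional expectation is linear.
-/
lemma hasLinkProb_diff (hS : MeasurableSet S) {T : Set (E × Plane × Plane)}
    (hT : MeasurableSet T) {q' : Ω → ℝ}
    (h : ∀ x y : Plane, x ≠ y →
      μ[{ω | (N.env ω, x, y) ∈ S}.indicator (fun _ => (1 : ℝ)) | N.geometry] =ᵐ[μ] q)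
    (h' : ∀ x y : Plane, x ≠ y →
      μ[{ω | (N.env ω, x, y) ∈ S ∩ T}.indicator (fun _ => (1 : ℝ)) | N.geometry] =ᵐ[μ] q') :
    N.HasLinkProb (S \ T) (fun ω => q ω - q' ω) := by
  intro x y hxy A hA
  refine measure_inter_of_condExp_indicator N.geometry_le
    (N.measurableSet_link (hS.diff hT) x y) ?_ hA
  have he : {ω | (N.env ω, x, y) ∈ S \ T}.indicator (fun _ => (1 : ℝ)) =
      {ω | (N.env ω, x, y) ∈ S}.indicator (fun _ => (1 : ℝ)) -
        {ω | (N.env ω, x, y) ∈ S ∩ T}.indicator (fun _ => (1 : ℝ)) := by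
    ext ω
    by_cases h1 : (N.env ω, x, y) ∈ S <;> by_cases h2 : (N.env ω, x, y) ∈ T <;>
      simp [indicator, h1, h2]
  rw [he]
  refine (condExp_sub ((integrable_const 1).indicator (N.measurableSet_link hS x y))
    ((integrable_const 1).indicator (N.measurableSet_link (hS.inter hT) x y)) _).trans ?_
  exact (h x y hxy).sub (h' x y hxy)

lemma hasLinkProb_los : N.HasLinkProb (N.los \ N.ref) (fun ω => N.PLos ω * (1 - N.PRef ω)) := by
  have := N.hasLinkProb_diff N.los_measurable N.ref_measurable N.los_prob N.los_ref_prob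
  convert this using 2 with ω
  simp only [PLos, PRef]
  ring

lemma hasLinkProb_ref : N.HasLinkProb (N.ref \ N.los) (fun ω => (1 - N.PLos ω) * N.PRef ω) := by
  have := N.hasLinkProb_diff N.ref_measurable N.los_measurable N.ref_prob
    (fun x y hxy => by rw [inter_comm]; exact N.los_ref_prob x y hxy)
  convert this using 2 with ω
  simp only [PLos, PRef]
  ring

/-- The two independence assumptions make the joint law a triple product, which is then
reassociated. This lets environment and base stations together serve as the mark of the eavesdropper
process. -/
lemma indep_env_bs_eve :
    IndepFun (fun ω => (N.env ω, pointMeasure (N.bs ω))) (fun ω => pointMeasure (N.eve ω)) μ := by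
  have he := N.env_measurable
  have hb := N.bs_hppp.measurable
  have hv := N.eve_hppp.measurable
  have := Measure.isProbabilityMeasure_map (μ := μ) he.aemeasurable
  have := Measure.isProbabilityMeasure_map (μ := μ) hb.aemeasurable
  have := Measure.isProbabilityMeasure_map (μ := μ) hv.aemeasurable
  rw [indepFun_iff_map_prod_eq_prod_map_map (he.prodMk hb).aemeasurable hv.aemeasurable,
    (indepFun_iff_map_prod_eq_prod_map_map he.aemeasurable hb.aemeasurable).1 N.indep_env_bs]
  have h1 := (indepFun_iff_map_prod_eq_prod_map_map he.aemeasurable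
    (hb.prodMk hv).aemeasurable).1 N.indep_env
  rw [(indepFun_iff_map_prod_eq_prod_map_map hb.aemeasurable hv.aemeasurable).1
    N.indep_bs_eve] at h1
  rw [← Measure.prodAssoc_prod, Eq.comm, MeasurableEquiv.map_apply_eq_iff_map_symm_apply_eq] at h1
  rw [h1, Measure.map_map (MeasurableEquiv.measurable _) (he.prodMk (hb.prodMk hv))]
  rfl

/-- The mean power received from the typical base station over the links in `S`. -/
lemma setLIntegral_signal (hq : N.HasLinkProb S q) (hS : MeasurableSet S) {α a : ℝ}
    (h : 0 < p.dref ∨ α < 2) (hα : 0 < α) (ha : 0 ≤ a) {A : Set Ω}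
    (hA : MeasurableSet[N.geometry] A) :
    ∫⁻ ω in A, ∫⁻ y, linkWeight p S α a (N.env ω, 0, y)
        ∂locFinKernel (pointMeasure (N.eve ω)) ∂μ =
      p.lamE * (ENNReal.ofReal (a * p.rangeLoss α) * ∫⁻ ω in A, ENNReal.ofReal (q ω) ∂μ) := by
  obtain ⟨B, hB, rfl⟩ := N.exists_env_preimage hA
  have hf : Measurable fun z : E × Plane => linkWeight p S α a (z.1, 0, z.2) :=
    (measurable_linkWeight p hS α a).comp
      (measurable_fst.prodMk (measurable_const.prodMk measurable_snd))
  rw [N.eve_hppp.setLIntegral_campbell N.env_measurable N.indep_env_eve hf hB,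
    ← p.lintegral_rangeLoss h hα ha, ← lintegral_mul_const]
  · congr 1
    refine lintegral_congr_ae ?_
    -- Link probabilities are prescribed for distinct endpoints only; the exceptional point is
    -- Lebesgue null.
    filter_upwards [(measure_eq_zero_iff_ae_notMem.1
      (measure_singleton (0 : Plane)) : ∀ᵐ y, y ∉ ({0} : Set Plane))] with y hy
    have := N.setLIntegral_linkWeight hq hS α a (x := 0) (y := y) (Ne.symm hy) hA
    simpa using this
  · exact Measurable.ite (measurableSet_le measurable_norm measurable_const)
      (((p.measurable_pathLoss α).comp measurable_norm).const_mul a).ennreal_ofReal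
      measurable_const

end Probability

end Network

/-! ### Mean interference of the other base stations -/

/-- The power received from the base station at `z.2.1` over links in `S` by an eavesdropper at
`z.2.2` in range of the typical base station. -/
def crossWeight {E : Type*} (p : Params) (S : Set (E × Plane × Plane)) (α a : ℝ)
    (z : E × Plane × Plane) : ℝ≥0∞ :=
  if ‖z.2.2‖ ≤ p.r then linkWeight p S α a z else 0

lemma measurable_crossWeight {E : Type*} [MeasurableSpace E] (p : Params)
    {S : Set (E × Plane × Plane)} (hS : MeasurableSet S) (α a : ℝ) :
    Measurable (crossWeight p S α a) :=
  Measurable.ite (measurableSet_le (measurable_snd.comp measurable_snd).norm measurable_const)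
    (measurable_linkWeight p hS α a) measurable_const

lemma crossWeight_ne_top {E : Type*} (p : Params) (S : Set (E × Plane × Plane)) (α a : ℝ)
    (z : E × Plane × Plane) : crossWeight p S α a z ≠ ∞ := by
  unfold crossWeight
  split_ifs
  · exact linkWeight_ne_top _ _ _ _ _
  · exact ENNReal.zero_ne_top

namespace Network

variable {p : Params} {Ω E : Type*} [MeasurableSpace Ω] [MeasurableSpace E] {μ : Measure Ω}
  (N : Network p E μ) {S : Set (E × Plane × Plane)} {q : Ω → ℝ}

/-- The power received by all eavesdroppers from the typical base station over the links in `S`. -/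
def signalSum (S : Set (E × Plane × Plane)) (α a : ℝ) (ω : Ω) : ℝ≥0∞ :=
  ∫⁻ y, linkWeight p S α a (N.env ω, 0, y) ∂locFinKernel (pointMeasure (N.eve ω))

/-- The power received by the eavesdroppers in range of the typical base station from all other
base stations over the links in `S`. -/
def crossSum (S : Set (E × Plane × Plane)) (α a : ℝ) (ω : Ω) : ℝ≥0∞ :=
  ∫⁻ y, ∫⁻ x, crossWeight p S α a (N.env ω, x, y)
    ∂locFinKernel (pointMeasure (N.bs ω)) ∂locFinKernel (pointMeasure (N.eve ω))

lemma measurable_signalSum (hS : MeasurableSet S) (α a : ℝ) :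
    Measurable (N.signalSum S α a) := by
  have hf : Measurable fun z : E × Plane => linkWeight p S α a (z.1, 0, z.2) :=
    (measurable_linkWeight p hS α a).comp
      (measurable_fst.prodMk (measurable_const.prodMk measurable_snd))
  have h := (IsHPPP.measurable_lintegral_locFinKernel hf).comp
    (N.env_measurable.prodMk N.eve_hppp.measurable)
  simp only [Function.comp_def] at h
  exact h

lemma measurable_lintegral_crossWeight (hS : MeasurableSet S) (α a : ℝ) :
    Measurable fun z : (E × Measure Plane) × Plane =>
      ∫⁻ x, crossWeight p S α a (z.1.1, x, z.2) ∂locFinKernel z.1.2 := by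
  have hf : Measurable fun z : (E × Plane) × Plane => crossWeight p S α a (z.1.1, z.2, z.1.2) :=
    (measurable_crossWeight p hS α a).comp ((measurable_fst.comp measurable_fst).prodMk
      (measurable_snd.prodMk (measurable_snd.comp measurable_fst)))
  have h := (IsHPPP.measurable_lintegral_locFinKernel hf).comp
    (((measurable_fst.comp measurable_fst).prodMk measurable_snd).prodMk
      ((measurable_snd : Measurable (Prod.snd : E × Measure Plane → _)).comp
        (measurable_fst : Measurable (Prod.fst : (E × Measure Plane) × Plane → _))))
  simp only [Function.comp_def] at h
  exact h

lemma measurable_crossSum (hS : MeasurableSet S) (α a : ℝ) :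
    Measurable (N.crossSum S α a) := by
  have h := (IsHPPP.measurable_lintegral_locFinKernel
    (measurable_lintegral_crossWeight (p := p) hS α a)).comp
    ((N.env_measurable.prodMk N.bs_hppp.measurable).prodMk N.eve_hppp.measurable)
  simp only [Function.comp_def] at h
  exact h

section Probability

variable [IsProbabilityMeasure μ]

/-- The mean power received from the other base stations over the links in `S`. -/
lemma setLIntegral_crossSum (hq : N.HasLinkProb S q) (hS : MeasurableSet S) {α a : ℝ}
    (h : 0 < p.dref ∨ α < 2) (hα : 0 < α) (ha : 0 ≤ a) {A : Set Ω}
    (hA : MeasurableSet[N.geometry] A) :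
    ∫⁻ ω in A, N.crossSum S α a ω ∂μ =
      p.lamE * (p.lamB * (ENNReal.ofReal (a * p.rangeLoss α) *
        ∫⁻ ω in A, ENNReal.ofReal (q ω) ∂μ) * ENNReal.ofReal (Real.pi * p.r ^ 2)) := by
  obtain ⟨B, hB, rfl⟩ := N.exists_env_preimage hA
  -- Campbell for the eavesdroppers with mark (environment, base stations); the base stations are
  -- averaged next, with the eavesdropper fixed at y.
  have h1 := N.eve_hppp.setLIntegral_campbell (N.env_measurable.prodMk N.bs_hppp.measurable)
    N.indep_env_bs_eve (measurable_lintegral_crossWeight (p := p) hS α a) (measurable_fst hB)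
  have hpre : (fun ω => (N.env ω, pointMeasure (N.bs ω))) ⁻¹' (Prod.fst ⁻¹' B) = N.env ⁻¹' B :=
    rfl
  rw [hpre] at h1
  unfold crossSum
  rw [h1]
  congr 1
  have h2 : ∀ y : Plane, ∫⁻ ω in N.env ⁻¹' B, ∫⁻ x, crossWeight p S α a (N.env ω, x, y)
      ∂locFinKernel (pointMeasure (N.bs ω)) ∂μ =
      (Metric.closedBall (0 : Plane) p.r).indicator (fun _ => p.lamB *
        (ENNReal.ofReal (a * p.rangeLoss α) *
          ∫⁻ ω in N.env ⁻¹' B, ENNReal.ofReal (q ω) ∂μ)) y := by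
    intro y
    have hf : Measurable fun z : E × Plane => crossWeight p S α a (z.1, z.2, y) :=
      (measurable_crossWeight p hS α a).comp
        (measurable_fst.prodMk (measurable_snd.prodMk measurable_const))
    rw [N.bs_hppp.setLIntegral_campbell N.env_measurable N.indep_env_bs hf hB]
    by_cases hy : ‖y‖ ≤ p.r
    · have hmem : y ∈ Metric.closedBall (0 : Plane) p.r := by simpa using hy
      rw [indicator_of_mem hmem, ← p.lintegral_rangeLoss h hα ha, ← lintegral_mul_const]
      · congr 1
        -- Translation invariance moves the disc around y to the origin, so the inner mean does not
        -- depend on y.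
        rw [← lintegral_sub_right_eq_self (fun x : Plane =>
          (if ‖x‖ ≤ p.r then ENNReal.ofReal (a * p.pathLoss α ‖x‖) else 0) *
            ∫⁻ ω in N.env ⁻¹' B, ENNReal.ofReal (q ω) ∂μ) y]
        refine lintegral_congr_ae ?_
        filter_upwards [(measure_eq_zero_iff_ae_notMem.1
          (measure_singleton y) : ∀ᵐ x, x ∉ ({y} : Set Plane))] with x hx
        rw [← N.setLIntegral_linkWeight hq hS α a hx hA]
        simp only [crossWeight, if_pos hy]
      · exact Measurable.ite (measurableSet_le measurable_norm measurable_const)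
          (((p.measurable_pathLoss α).comp measurable_norm).const_mul a).ennreal_ofReal
          measurable_const
    · have hmem : y ∉ Metric.closedBall (0 : Plane) p.r := by simpa using hy
      rw [indicator_of_notMem hmem]
      simp [crossWeight, hy]
  simp_rw [h2]
  rw [lintegral_indicator measurableSet_closedBall, setLIntegral_const,
    EuclideanSpace.volume_closedBall_fin_two, ENNReal.ofReal_mul Real.pi_nonneg,
    ENNReal.ofReal_pow p.r_pos.le, mul_comm (ENNReal.ofReal Real.pi)]

/-- The mean of `signalSum` given the geometry. -/
lemma condExp_signalSum (hq : N.HasLinkProb S q) (hS : MeasurableSet S)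
    (hqm : Measurable[N.geometry] q) (hq0 : 0 ≤ᵐ[μ] q) (hqi : Integrable q μ) {α a : ℝ}
    (h : 0 < p.dref ∨ α < 2) (hα : 0 < α) (ha : 0 ≤ a) :
    Integrable (fun ω => (N.signalSum S α a ω).toReal) μ ∧
      μ[fun ω => (N.signalSum S α a ω).toReal | N.geometry] =ᵐ[μ]
        fun ω => p.lamE * (a * p.rangeLoss α) * q ω := by
  have hc : 0 ≤ a * p.rangeLoss α := mul_nonneg ha (p.rangeLoss_pos h hα).le
  have hc' : 0 ≤ p.lamE * (a * p.rangeLoss α) := by positivity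
  refine condExp_toReal N.geometry_le (N.measurable_signalSum hS α a)
    (hqm.const_mul _) ?_ (hqi.const_mul _) fun A hA => ?_
  · filter_upwards [hq0] with ω hω using mul_nonneg hc' hω
  · unfold signalSum
    rw [N.setLIntegral_signal hq hS h hα ha hA]
    simp_rw [ENNReal.ofReal_mul hc']
    rw [lintegral_const_mul _ (hqm.mono N.geometry_le le_rfl).ennreal_ofReal,
      ENNReal.ofReal_mul p.lamE.coe_nonneg, ENNReal.ofReal_coe_nnreal, mul_assoc]

/-- The mean of the sum of `crossSum` over two kinds of links given the geometry. -/
lemma condExp_crossSum_add {S' : Set (E × Plane × Plane)} {q' : Ω → ℝ}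
    (hq : N.HasLinkProb S q) (hS : MeasurableSet S)
    (hqm : Measurable[N.geometry] q) (hq0 : 0 ≤ᵐ[μ] q) (hqi : Integrable q μ)
    (hq' : N.HasLinkProb S' q') (hS' : MeasurableSet S')
    (hqm' : Measurable[N.geometry] q') (hq0' : 0 ≤ᵐ[μ] q') (hqi' : Integrable q' μ)
    {α a α' a' : ℝ} (h : 0 < p.dref ∨ α < 2) (hα : 0 < α) (ha : 0 ≤ a)
    (h' : 0 < p.dref ∨ α' < 2) (hα' : 0 < α') (ha' : 0 ≤ a') :
    Integrable (fun ω => (N.crossSum S α a ω + N.crossSum S' α' a' ω).toReal) μ ∧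
      μ[fun ω => (N.crossSum S α a ω + N.crossSum S' α' a' ω).toReal | N.geometry] =ᵐ[μ]
        fun ω => p.lamE * p.lamB * (Real.pi * p.r ^ 2) * (a * p.rangeLoss α) * q ω +
          p.lamE * p.lamB * (Real.pi * p.r ^ 2) * (a' * p.rangeLoss α') * q' ω := by
  have hpi : 0 ≤ Real.pi * p.r ^ 2 := by positivity
  have hc : 0 ≤ a * p.rangeLoss α := mul_nonneg ha (p.rangeLoss_pos h hα).le
  have hc' : 0 ≤ a' * p.rangeLoss α' := mul_nonneg ha' (p.rangeLoss_pos h' hα').le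
  have hd : 0 ≤ p.lamE * p.lamB * (Real.pi * p.r ^ 2) * (a * p.rangeLoss α) := by positivity
  have hd' : 0 ≤ p.lamE * p.lamB * (Real.pi * p.r ^ 2) * (a' * p.rangeLoss α') := by positivity
  refine condExp_toReal N.geometry_le
    ((N.measurable_crossSum hS α a).add (N.measurable_crossSum hS' α' a'))
    ((hqm.const_mul _).add (hqm'.const_mul _)) ?_ ((hqi.const_mul _).add (hqi'.const_mul _))
    fun A hA => ?_
  · filter_upwards [hq0, hq0'] with ω hω hω' using
      add_nonneg (mul_nonneg hd hω) (mul_nonneg hd' hω')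
  · have he : ∀ b : ℝ, 0 ≤ b → ENNReal.ofReal (p.lamE * p.lamB * (Real.pi * p.r ^ 2) * b) =
        p.lamE * p.lamB * ENNReal.ofReal (Real.pi * p.r ^ 2) * ENNReal.ofReal b := by
      intro b hb
      rw [ENNReal.ofReal_mul (by positivity), ENNReal.ofReal_mul (by positivity),
        ENNReal.ofReal_mul (by positivity), ENNReal.ofReal_coe_nnreal, ENNReal.ofReal_coe_nnreal]
    have hr : ∀ᵐ ω ∂μ.restrict A,
        ENNReal.ofReal (p.lamE * p.lamB * (Real.pi * p.r ^ 2) * (a * p.rangeLoss α) * q ω +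
          p.lamE * p.lamB * (Real.pi * p.r ^ 2) * (a' * p.rangeLoss α') * q' ω) =
        p.lamE * p.lamB * ENNReal.ofReal (Real.pi * p.r ^ 2) *
            ENNReal.ofReal (a * p.rangeLoss α) * ENNReal.ofReal (q ω) +
          p.lamE * p.lamB * ENNReal.ofReal (Real.pi * p.r ^ 2) *
            ENNReal.ofReal (a' * p.rangeLoss α') * ENNReal.ofReal (q' ω) := by
      refine ae_restrict_of_ae ?_
      filter_upwards [hq0, hq0'] with ω hω hω'
      rw [ENNReal.ofReal_add (mul_nonneg hd hω) (mul_nonneg hd' hω'), ENNReal.ofReal_mul hd,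
        ENNReal.ofReal_mul hd', he _ hc, he _ hc']
    have hm := (hqm.mono N.geometry_le le_rfl).ennreal_ofReal
    have hm' := (hqm'.mono N.geometry_le le_rfl).ennreal_ofReal
    simp only [Pi.add_apply]
    rw [lintegral_congr_ae hr, lintegral_add_left (N.measurable_crossSum hS α a),
      N.setLIntegral_crossSum hq hS h hα ha hA, N.setLIntegral_crossSum hq' hS' h' hα' ha' hA,
      lintegral_add_left (hm.const_mul _), lintegral_const_mul _ hm, lintegral_const_mul _ hm']
    ring

end Probability

/-! ### The real-valued powers as extended nonnegative integrals -/

lemma losPower_eq (ω : Ω) (x y : Plane) : N.losPower ω x y =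
    (linkWeight p (N.los \ N.ref) p.αL (p.Pt * p.meanGain) (N.env ω, x, y)).toReal := by
  have h0 : 0 ≤ p.Pt * p.meanGain * p.pathLoss p.αL (dist x y) :=
    mul_nonneg (mul_nonneg p.Pt_pos.le p.meanGain_pos.le) (p.pathLoss_nonneg _ _)
  unfold losPower linkWeight indicator
  by_cases h1 : dist x y ≤ p.r <;> by_cases h2 : (N.env ω, x, y) ∈ N.los \ N.ref <;>
    simp only [h1, h2, and_self, and_true, and_false, if_true, if_false, ENNReal.toReal_ofReal h0,
      ENNReal.toReal_zero]

lemma refPower_eq (ω : Ω) (x y : Plane) : N.refPower ω x y =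
    (linkWeight p (N.ref \ N.los) p.αN (p.Pt * p.meanGain * p.ρ) (N.env ω, x, y)).toReal := by
  have h0 : 0 ≤ p.Pt * p.meanGain * p.ρ * p.pathLoss p.αN (dist x y) :=
    mul_nonneg (mul_nonneg (mul_nonneg p.Pt_pos.le p.meanGain_pos.le) p.ρ_nonneg)
      (p.pathLoss_nonneg _ _)
  unfold refPower linkWeight indicator
  by_cases h1 : dist x y ≤ p.r <;> by_cases h2 : (N.env ω, x, y) ∈ N.ref \ N.los <;>
    simp only [h1, h2, and_self, and_true, and_false, if_true, if_false, ENNReal.toReal_ofReal h0,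
      ENNReal.toReal_zero]
  ring

/-- Finiteness of each term is enough: a divergent sum would give 0 on both sides. -/
lemma tsum_linkWeight_toReal (S : Set (E × Plane × Plane)) (α a : ℝ) (ω : Ω) :
    ∑' y : N.eve ω, (linkWeight p S α a (N.env ω, 0, y)).toReal =
      (N.signalSum S α a ω).toReal := by
  rw [signalSum, N.eve_hppp.locFinKernel_pointMeasure, N.eve_hppp.lintegral_pointMeasure,
    ENNReal.tsum_toReal_eq fun y => linkWeight_ne_top _ _ _ _ _]

/-- Local finiteness leaves only finitely many base stations within r of y. This allows `toReal` to
pass through the outer sum in `iCross_eq`. -/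
lemma lintegral_crossWeight_ne_top (S : Set (E × Plane × Plane)) (α a : ℝ) (ω : Ω) (y : Plane) :
    ∫⁻ x, crossWeight p S α a (N.env ω, x, y) ∂pointMeasure (N.bs ω) ≠ ∞ := by
  have hfin := N.bs_hppp.inter_finite ω (Metric.isBounded_closedBall (x := y) (r := p.r))
  rw [N.bs_hppp.lintegral_pointMeasure,
    tsum_eq_sum (s := (hfin.preimage (Subtype.val_injective.injOn (s :=
      ((↑) : N.bs ω → Plane) ⁻¹' (N.bs ω ∩ Metric.closedBall y p.r)))).toFinset)]
  · exact ENNReal.sum_ne_top.2 fun _ _ => crossWeight_ne_top _ _ _ _ _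
  · intro x hx
    have hx' : p.r < dist (x : Plane) y := by
      simpa using hx
    unfold crossWeight
    split_ifs
    · exact linkWeight_of_lt p S α a hx'
    · rfl

lemma iCross_eq (ω : Ω) :
    (N.powers ω).iCross =
      (N.crossSum (N.los \ N.ref) p.αL (p.Pt * p.meanGain) ω +
        N.crossSum (N.ref \ N.los) p.αN (p.Pt * p.meanGain * p.ρ) ω).toReal := by
  set S := N.los \ N.ref
  set T := N.ref \ N.los
  set a := p.Pt * p.meanGain
  have hin : ∀ y : Plane, ∑' x : N.bs ω,
      (if dist (0 : Plane) y ≤ p.r then N.losPower ω x y + N.refPower ω x y else 0) =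
      (∫⁻ x, crossWeight p S p.αL a (N.env ω, x, y) ∂pointMeasure (N.bs ω) +
        ∫⁻ x, crossWeight p T p.αN (a * p.ρ) (N.env ω, x, y) ∂pointMeasure (N.bs ω)).toReal := by
    intro y
    rw [N.bs_hppp.lintegral_pointMeasure, N.bs_hppp.lintegral_pointMeasure, ← ENNReal.tsum_add,
      ENNReal.tsum_toReal_eq fun x => ENNReal.add_ne_top.2
        ⟨crossWeight_ne_top _ _ _ _ _, crossWeight_ne_top _ _ _ _ _⟩]
    refine tsum_congr fun x => ?_
    rw [ENNReal.toReal_add (crossWeight_ne_top _ _ _ _ _) (crossWeight_ne_top _ _ _ _ _),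
      dist_zero_left, N.losPower_eq, N.refPower_eq]
    unfold crossWeight
    split_ifs <;> simp [S, T, a]
  have hout : (N.powers ω).iCross = ∑' y : N.eve ω, ∑' x : N.bs ω,
      (if dist (0 : Plane) y ≤ p.r then N.losPower ω x y + N.refPower ω x y else 0) := by
    unfold powers
    congr! 4
  rw [hout]
  simp_rw [hin]
  rw [← ENNReal.tsum_toReal_eq fun y : N.eve ω => ENNReal.add_ne_top.2
    ⟨N.lintegral_crossWeight_ne_top _ _ _ ω y, N.lintegral_crossWeight_ne_top _ _ _ ω y⟩,
    ENNReal.tsum_add, crossSum, crossSum, N.eve_hppp.locFinKernel_pointMeasure,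
    N.bs_hppp.locFinKernel_pointMeasure, N.eve_hppp.lintegral_pointMeasure,
    N.eve_hppp.lintegral_pointMeasure]

lemma sLos_eq (ω : Ω) : (N.powers ω).sLos =
    (1 - p.η) * (N.signalSum (N.los \ N.ref) p.αL (p.Pt * p.meanGain) ω).toReal := by
  simp only [powers, N.losPower_eq, tsum_mul_left, N.tsum_linkWeight_toReal]

lemma sRef_eq (ω : Ω) : (N.powers ω).sRef =
    (1 - p.η) * (N.signalSum (N.ref \ N.los) p.αN (p.Pt * p.meanGain * p.ρ) ω).toReal := by
  simp only [powers, N.refPower_eq, tsum_mul_left, N.tsum_linkWeight_toReal]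

lemma iLos_eq (ω : Ω) : (N.powers ω).iLos =
    p.η * (N.signalSum (N.los \ N.ref) p.αL (p.Pt * p.meanGain) ω).toReal := by
  simp only [powers, N.losPower_eq, tsum_mul_left, N.tsum_linkWeight_toReal]

lemma iRef_eq (ω : Ω) : (N.powers ω).iRef =
    p.η * (N.signalSum (N.ref \ N.los) p.αN (p.Pt * p.meanGain * p.ρ) ω).toReal := by
  simp only [powers, N.refPower_eq, tsum_mul_left, N.tsum_linkWeight_toReal]

end Network

/-! ### Mean powers given the geometry -/

namespace Network

variable {p : Params} {Ω E : Type*} [MeasurableSpace Ω] [MeasurableSpace E] {μ : Measure Ω}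
  (N : Network p E μ)

/-- The mean power received from the typical base station over line-of-sight links, before time
switching. -/
def meanLos (ω : Ω) : ℝ :=
  p.lamE * (p.Pt * p.meanGain * p.rangeLoss p.αL) * (N.PLos ω * (1 - N.PRef ω))

/-- The mean power received from the typical base station over reflected links, before time
switching. -/
def meanRef (ω : Ω) : ℝ :=
  p.lamE * (p.Pt * p.meanGain * p.ρ * p.rangeLoss p.αN) * ((1 - N.PLos ω) * N.PRef ω)

variable [IsProbabilityMeasure μ]

/-- The aggregate powers are integrable, and their means given the geometry. -/
lemma integrable_powers_and_meanPowers (hL : 0 < p.dref ∨ p.αL < 2)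
    (hN : 0 < p.dref ∨ p.αN < 2) :
    (Integrable (fun ω => (N.powers ω).sLos) μ ∧ Integrable (fun ω => (N.powers ω).sRef) μ ∧
      Integrable (fun ω => (N.powers ω).iLos) μ ∧ Integrable (fun ω => (N.powers ω).iRef) μ ∧
      Integrable (fun ω => (N.powers ω).iCross) μ) ∧
    ∀ᵐ ω ∂μ, (N.meanPowers ω).signal = (1 - p.η) * (N.meanLos ω + N.meanRef ω) ∧
      (N.meanPowers ω).interference =
        (Real.pi * p.r ^ 2 * p.lamB + p.η) * (N.meanLos ω + N.meanRef ω) := by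
  have haL : 0 ≤ p.Pt * p.meanGain := (mul_pos p.Pt_pos p.meanGain_pos).le
  have haN : 0 ≤ p.Pt * p.meanGain * p.ρ := mul_nonneg haL p.ρ_nonneg
  have hbd : ∀ᵐ ω ∂μ, (0 ≤ N.PLos ω * (1 - N.PRef ω) ∧ N.PLos ω * (1 - N.PRef ω) ≤ 1) ∧
      0 ≤ (1 - N.PLos ω) * N.PRef ω ∧ (1 - N.PLos ω) * N.PRef ω ≤ 1 := by
    filter_upwards [N.PLos_le_one, N.PRef_le_one] with ω h1 h2
    have h3 := N.PLos_pos ω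
    have h4 := N.PRef_pos ω
    refine ⟨⟨?_, ?_⟩, ?_, ?_⟩ <;> nlinarith
  have hmL : Measurable[N.geometry] fun ω => N.PLos ω * (1 - N.PRef ω) :=
    N.measurable_PLos.mul (measurable_const.sub N.measurable_PRef)
  have hmN : Measurable[N.geometry] fun ω => (1 - N.PLos ω) * N.PRef ω :=
    (measurable_const.sub N.measurable_PLos).mul N.measurable_PRef
  have h0L : 0 ≤ᵐ[μ] fun ω => N.PLos ω * (1 - N.PRef ω) := hbd.mono fun ω h => h.1.1
  have h0N : 0 ≤ᵐ[μ] fun ω => (1 - N.PLos ω) * N.PRef ω := hbd.mono fun ω h => h.2.1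
  have hiL : Integrable (fun ω => N.PLos ω * (1 - N.PRef ω)) μ :=
    Integrable.of_bound (hmL.mono N.geometry_le le_rfl).aestronglyMeasurable 1
      (hbd.mono fun ω h => by rw [Real.norm_of_nonneg h.1.1]; exact h.1.2)
  have hiN : Integrable (fun ω => (1 - N.PLos ω) * N.PRef ω) μ :=
    Integrable.of_bound (hmN.mono N.geometry_le le_rfl).aestronglyMeasurable 1
      (hbd.mono fun ω h => by rw [Real.norm_of_nonneg h.2.1]; exact h.2.2)
  have hSL := N.los_measurable.diff N.ref_measurable
  have hSN := N.ref_measurable.diff N.los_measurable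
  obtain ⟨iL, eL⟩ := N.condExp_signalSum N.hasLinkProb_los hSL hmL h0L hiL hL p.αL_pos haL
  obtain ⟨iN, eN⟩ := N.condExp_signalSum N.hasLinkProb_ref hSN hmN h0N hiN hN p.αN_pos haN
  obtain ⟨iC, eC⟩ := N.condExp_crossSum_add N.hasLinkProb_los hSL hmL h0L hiL
    N.hasLinkProb_ref hSN hmN h0N hiN hL p.αL_pos haL hN p.αN_pos haN
  refine ⟨?_, ?_⟩
  · simp only [sLos_eq, sRef_eq, iLos_eq, iRef_eq, iCross_eq]
    exact ⟨iL.const_mul _, iN.const_mul _, iL.const_mul _, iN.const_mul _, iC⟩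
  · filter_upwards [eL, eN, eC,
      condExp_smul (μ := μ) (1 - p.η) (fun ω => (N.signalSum (N.los \ N.ref) p.αL
        (p.Pt * p.meanGain) ω).toReal) N.geometry,
      condExp_smul (μ := μ) (1 - p.η) (fun ω => (N.signalSum (N.ref \ N.los) p.αN
        (p.Pt * p.meanGain * p.ρ) ω).toReal) N.geometry,
      condExp_smul (μ := μ) p.η (fun ω => (N.signalSum (N.los \ N.ref) p.αL
        (p.Pt * p.meanGain) ω).toReal) N.geometry,
      condExp_smul (μ := μ) p.η (fun ω => (N.signalSum (N.ref \ N.los) p.αN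
        (p.Pt * p.meanGain * p.ρ) ω).toReal) N.geometry] with ω e1 e2 e3 s1 s2 s3 s4
    rw [Pi.smul_apply, smul_eq_mul, e1] at s1 s3
    rw [Pi.smul_apply, smul_eq_mul, e2] at s2 s4
    simp only [Powers.signal, Powers.interference, meanPowers, sLos_eq, sRef_eq, iLos_eq, iRef_eq,
      iCross_eq, meanLos, meanRef]
    refine ⟨(congrArg₂ (· + ·) s1 s2).trans ?_,
      (congrArg₂ (· + ·) (congrArg₂ (· + ·) s3 s4) e3).trans ?_⟩ <;> ring

end Network

end MmWave

end

/-! ### The approximate eavesdropping success probability -/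

theorem theorem2 {Ω E : Type*} [MeasurableSpace Ω] [MeasurableSpace E] (μ : Measure Ω)
    [IsProbabilityMeasure μ] (p : MmWave.Params) (N : MmWave.Network p E μ)
    (hαL : p.αL ≠ 2) (hαN : p.αN ≠ 2)
    (hdref : 0 < p.dref ∨ (p.αL < 2 ∧ p.αN < 2))
    (hbracket : ∀ᵐ ω ∂μ, p.bracket (N.PLos ω) (N.PRef ω) ≠ 0) :
    -- the aggregate powers have means, and the approximate SINR has a positive denominator
    (Integrable (fun ω => (N.powers ω).sLos) μ ∧ Integrable (fun ω => (N.powers ω).sRef) μ ∧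
      Integrable (fun ω => (N.powers ω).iLos) μ ∧ Integrable (fun ω => (N.powers ω).iRef) μ ∧
      Integrable (fun ω => (N.powers ω).iCross) μ) ∧
    (∀ᵐ ω ∂μ, 0 < (N.meanPowers ω).interference) ∧
    -- the approximate eavesdropping success probability
    (∀ β : ℝ, N.approxEsp β =
      μ {ω | β < p.numer (N.PLos ω) (N.PRef ω) / p.denom (N.PLos ω) (N.PRef ω)}) ∧
    -- for the pure power law, numerator and denominator are the mean signal and the mean
    -- interference, up to one common positive factor
    (p.dref = 0 → ∀ᵐ ω ∂μ,
      (N.meanPowers ω).signal =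
        Real.pi * p.r ^ 2 * p.lamE * p.Pt * p.meanGain * p.b * p.numer (N.PLos ω) (N.PRef ω) ∧
      (N.meanPowers ω).interference =
        Real.pi * p.r ^ 2 * p.lamE * p.Pt * p.meanGain * p.b * p.denom (N.PLos ω) (N.PRef ω)) := by
  have hL : 0 < p.dref ∨ p.αL < 2 := hdref.imp_right And.left
  have hN : 0 < p.dref ∨ p.αN < 2 := hdref.imp_right And.right
  obtain ⟨hint, hmean⟩ := N.integrable_powers_and_meanPowers hL hN
  have hcoef : 0 < Real.pi * p.r ^ 2 * p.lamB + p.η := by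
    have := p.η_pos
    positivity
  have hpos : ∀ᵐ ω ∂μ, 0 < N.meanLos ω + N.meanRef ω := by
    filter_upwards [hbracket, N.PLos_le_one, N.PRef_le_one] with ω hb h1 h2
    have hA : 0 < p.lamE * (p.Pt * p.meanGain * p.rangeLoss p.αL) :=
      mul_pos p.lamE_pos (mul_pos (mul_pos p.Pt_pos p.meanGain_pos)
        (p.rangeLoss_pos hL p.αL_pos))
    have hB : 0 < p.lamE * (p.Pt * p.meanGain * p.rangeLoss p.αN) :=
      mul_pos p.lamE_pos (mul_pos (mul_pos p.Pt_pos p.meanGain_pos)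
        (p.rangeLoss_pos hN p.αN_pos))
    have hx : 0 ≤ N.PLos ω * (1 - N.PRef ω) :=
      mul_nonneg (N.PLos_pos ω).le (sub_nonneg.2 h2)
    have hy : 0 ≤ p.ρ * ((1 - N.PLos ω) * N.PRef ω) :=
      mul_nonneg p.ρ_nonneg (mul_nonneg (sub_nonneg.2 h1) (N.PRef_pos ω).le)
    have he : N.meanLos ω + N.meanRef ω =
        p.lamE * (p.Pt * p.meanGain * p.rangeLoss p.αL) * (N.PLos ω * (1 - N.PRef ω)) +
        p.lamE * (p.Pt * p.meanGain * p.rangeLoss p.αN) *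
          (p.ρ * ((1 - N.PLos ω) * N.PRef ω)) := by
      unfold MmWave.Network.meanLos MmWave.Network.meanRef
      ring
    rw [he]
    -- The bracket and the mean power combine the same two nonnegative quantities. If both vanished,
    -- so would the bracket; the mean power has positive coefficients, whatever the signs of 2 - α
    -- in the bracket.
    rcases hx.lt_or_eq with hx' | hx'
    · exact add_pos_of_pos_of_nonneg (mul_pos hA hx') (mul_nonneg hB.le hy)
    · refine add_pos_of_nonneg_of_pos (mul_nonneg hA.le hx) (mul_pos hB (hy.lt_of_ne ?_))
      intro hy'
      apply hb
      rw [MmWave.Params.bracket, ← hx', mul_assoc p.ρ, ← hy']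
      ring
  refine ⟨hint, ?_, fun β => ?_, fun h0 => ?_⟩
  · filter_upwards [hmean, hpos] with ω h1 h2
    rw [h1.2]
    exact mul_pos hcoef h2
  · refine measure_congr ?_
    -- Both quotients reduce to (1 - η) / (π r² λ_b + η), one by cancelling the mean power, the
    -- other by cancelling the bracket.
    filter_upwards [hmean, hpos, hbracket] with ω h1 h2 h3
    refine propext (iff_of_eq (congrArg (β < ·) ?_))
    rw [MmWave.Network.approxSinr, MmWave.Powers.sinr, add_zero, h1.1, h1.2,
      mul_div_mul_right _ _ h2.ne', MmWave.Params.numer, MmWave.Params.denom,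
      mul_div_mul_right _ _ h3]
  · have hlt := hdref.resolve_left (by rw [h0]; exact lt_irrefl _)
    filter_upwards [hmean] with ω h1
    have he : N.meanLos ω + N.meanRef ω = Real.pi * p.r ^ 2 * p.lamE * p.Pt * p.meanGain * p.b *
        p.bracket (N.PLos ω) (N.PRef ω) := by
      rw [MmWave.Network.meanLos, MmWave.Network.meanRef, MmWave.Params.bracket,
        p.rangeLoss_of_dref_eq_zero h0 hlt.1, p.rangeLoss_of_dref_eq_zero h0 hlt.2]
      ring
    rw [h1.1, h1.2, he, MmWave.Params.numer, MmWave.Params.denom]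
    constructor <;> ring
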